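/- Let $n\ge 2$, $-1<w<\frac1{n-1}$, and put $c=\sqrt{(n-1)(w+1)/n}$, $\ell=\sqrt{(1-w(n-1))/n}$. For unit vectors $v_1,\dots,v_m\in\mathbb R^m$ with $v_i\cdot v_j=-\omega$ for all $i\ne j$, the simplex $\{\sum_i\lambda_iv_i : 1\ge\lambda_1\ge\dots\ge\lambda_m\ge 0\}$ is called a realization of $Q_m(\omega)$. The standard realization is the one with $v_i=(b,\dots,b,a,b,\dots,b)$ ($a$ in position $i$), where $b=(\sqrt{1-\omega(m-1)}-\sqrt{1+\omega})/m$ and $a=b+\sqrt{1+\omega}$. Let $P_m=Q_m(1/m)$. For $A\subset\mathbb R^{n-1}$, $A\times I_\ell\subset\mathbb R^n$ is the prism with $I_\ell=[0,\ell]$. A polytope is a union of a finite, positive number of nondegenerate $n$-dimensional simplices in $\mathbb R^n$. A polytope is dissected into polytopes if it is their union and their interiors are pairwise disjoint. Two polytopes in $\mathbb R^n$ are equidissectable if they can be dissected into equally many polytopes that are congruent in pairs (reflections are allowed). (1) $Q_n(w)$ is equidissectable with the prism $c\,P_{n-1}\times I_\ell$, for all realizations of $Q_n(w)$ and $P_{n-1}$.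 (2) For the standard realizations, the dissection can be made with the $n$ pieces into which $Q_n(w)$ is cut by the hyperplanes $\sum_i x_i=k\sqrt{1-w(n-1)}$, $k=1,\dots,n-1$, i.e. with the pieces $T_k=\{x\in Q_n(w): k\sqrt{1-w(n-1)}\le\sum_i x_i\le(k+1)\sqrt{1-w(n-1)}\}$, $k=0,\dots,n-1$: these are polytopes, they dissect $Q_n(w)$, and suitable isometric copies of them dissect $c\,P_{n-1}\times I_\ell$. (3) For $n=3$ the three pieces are those of Schöbi's dissection: if $u_k=v_1+\dots+v_k$ ($0\le k\le 3$) are the vertices of the standard $Q_3(w)$, then $T_1$, the image of $T_0$ under the half-turn about the line through $u_1$ and $\frac12(u_0+u_2)$, and the image of $T_2$ under the half-turn about the line through $u_2$ and $\frac12(u_1+u_3)$ dissect a prism congruent to $c\,P_2\times I_\ell$. -/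

import Mathlib

open scoped Pointwise RealInnerProductSpace

/-- Euclidean `n`-space. -/
abbrev Euc (n : ℕ) : Type := EuclideanSpace ℝ (Fin n)

/-- `n` unit vectors in `ℝⁿ` whose pairwise inner products are all equal to `-w`. -/
def IsHillFrame {n : ℕ} (w : ℝ) (v : Fin n → Euc n) : Prop :=
  (∀ i, ‖v i‖ = 1) ∧ ∀ i j, i ≠ j → ⟪v i, v j⟫ = -w

/-- The simplex of all points `∑ μ i • v i` with `1 ≥ μ 0 ≥ μ 1 ≥ ⋯ ≥ μ (n-1) ≥ 0`. For a frame `v`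
with inner products `-w` this is (a realization of) the Hill simplex `Q_n(w)` of the first type. -/
def hillSimplex {n : ℕ} (v : Fin n → Euc n) : Set (Euc n) :=
  {x | ∃ μ : Fin n → ℝ, Antitone μ ∧ (∀ i, 0 ≤ μ i ∧ μ i ≤ 1) ∧ x = ∑ i, μ i • v i}

/-- The off-diagonal entry of the standard frame. -/
noncomputable def frameB (n : ℕ) (w : ℝ) : ℝ :=
  (√(1 - w * ((n : ℝ) - 1)) - √(1 + w)) / n

/-- The diagonal entry of the standard frame. -/
noncomputable def frameA (n : ℕ) (w : ℝ) : ℝ := frameB n w + √(1 + w)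

/-- The standard frame `v_1 = (a, b, …, b)`, `v_2 = (b, a, b, …, b)`, …, `v_n = (b, …, b, a)`. -/
noncomputable def stdFrame (n : ℕ) (w : ℝ) (i : Fin n) : Euc n :=
  WithLp.toLp 2 fun j => if j = i then frameA n w else frameB n w

/-- The standard frame is a frame of unit vectors with pairwise inner products `-w`. -/
theorem isHillFrame_stdFrame {n : ℕ} (hn : 1 ≤ n) {w : ℝ} (h₁ : 0 ≤ 1 + w)
    (h₂ : 0 ≤ 1 - w * ((n : ℝ) - 1)) : IsHillFrame w (stdFrame n w) := by
  have hn0 : (n : ℝ) ≠ 0 := by positivity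
  have hb : (n : ℝ) * frameB n w = √(1 - w * ((n : ℝ) - 1)) - √(1 + w) := by
    unfold frameB; field_simp
  have q₁ := Real.sq_sqrt h₁
  have q₂ := Real.sq_sqrt h₂
  have key : (n : ℝ) * frameB n w ^ 2 + 2 * frameB n w * √(1 + w) = -w := by
    apply mul_left_cancel₀ hn0
    have e : (n : ℝ) * ((n : ℝ) * frameB n w ^ 2 + 2 * frameB n w * √(1 + w))
        = (n * frameB n w) ^ 2 + 2 * (n * frameB n w) * √(1 + w) := by ring
    rw [e, hb]
    linear_combination q₂ - q₁
  have hs : ∀ i j, ⟪stdFrame n w i, stdFrame n w j⟫ =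
      (n : ℝ) * frameB n w ^ 2 + 2 * frameB n w * √(1 + w) + if i = j then 1 + w else 0 := by
    intro i j
    have e : ∀ k : Fin n, stdFrame n w j k * stdFrame n w i k
        = frameB n w ^ 2 + (if k = i then frameB n w * √(1 + w) else 0)
          + (if k = j then frameB n w * √(1 + w) + (if i = j then 1 + w else 0) else 0) := by
      intro k
      simp only [stdFrame, frameA]
      split_ifs <;> first | (exfalso; simp_all; done) | (linear_combination q₁) | ring
    simp only [PiLp.inner_apply, RCLike.inner_apply, conj_trivial, e, Finset.sum_add_distrib,
      Finset.sum_ite_eq', Finset.mem_univ, if_true, Finset.sum_const, Finset.card_univ,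
      Fintype.card_fin, nsmul_eq_mul]
    ring
  refine ⟨fun i => ?_, fun i j hij => ?_⟩
  · have h := hs i i
    rw [key, if_pos rfl, real_inner_self_eq_norm_sq] at h
    have h' : ‖stdFrame n w i‖ ^ 2 = 1 := by linarith
    exact (pow_eq_one_iff_of_nonneg (norm_nonneg _) two_ne_zero).mp h'
  · rw [hs, key, if_neg hij, add_zero]

/-- The standard realization of the Hill simplex `Q_n(w)`. -/
noncomputable def hillQ (n : ℕ) (w : ℝ) : Set (Euc n) := hillSimplex (stdFrame n w)

/-- `P_n = Q_n(1/n)`. -/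
noncomputable def hillP (n : ℕ) : Set (Euc n) := hillQ n (1 / (n : ℝ))

/-- The prism `A × I_l` in `ℝⁿ` over a base `A ⊆ ℝⁿ⁻¹`, with `I_l = [0, l]`: the first `n - 1`
coordinates form a point of `A`, the last one lies in `[0, l]`. -/
def prism {n : ℕ} (A : Set (Euc (n - 1))) (l : ℝ) : Set (Euc n) :=
  {x | ∃ y ∈ A, ∃ t ∈ Set.Icc 0 l,
    x = WithLp.toLp 2 fun i : Fin n => if h : i.val < n - 1 then y ⟨i.val, h⟩ else t}

/-- A polytope in `ℝⁿ`: a union of finitely many (and at least one) nondegenerate `n`-dimensional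
simplices. -/
def IsPolytope {n : ℕ} (P : Set (Euc n)) : Prop :=
  ∃ (k : ℕ) (s : Fin (k + 1) → Affine.Simplex ℝ (Euc n) n),
    P = ⋃ i, convexHull ℝ (Set.range (s i).points)

/-- `P = p_1 + ⋯ + p_k`: the `p i` are polytopes with pairwise disjoint interiors and union `P`. -/
def IsDissection {n k : ℕ} (P : Set (Euc n)) (p : Fin k → Set (Euc n)) : Prop :=
  (∀ i, IsPolytope (p i)) ∧
  (∀ i j, i ≠ j → Disjoint (interior (p i)) (interior (p j))) ∧
  P = ⋃ i, p i

/-- `P` and `Q` are equidissectable by means of the pieces `p i` of `P`: these dissect `P`, and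
suitable isometric copies of them dissect `Q`. -/
def EquidissectableVia {n k : ℕ} (P Q : Set (Euc n)) (p : Fin k → Set (Euc n)) : Prop :=
  IsDissection P p ∧ ∃ q : Fin k → Set (Euc n), IsDissection Q q ∧
    ∀ i, ∃ g : Euc n ≃ᵢ Euc n, g '' p i = q i

/-- Equidissectability under the full group of isometries of `ℝⁿ`. -/
def Equidissectable {n : ℕ} (P Q : Set (Euc n)) : Prop :=
  ∃ (k : ℕ) (p : Fin k → Set (Euc n)), 1 ≤ k ∧ EquidissectableVia P Q p

/-- The piece of `Q_n(w)` between the hyperplanes `∑ x_i = k √(1 - w(n-1))` and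
`∑ x_i = (k+1) √(1 - w(n-1))`. -/
noncomputable def hillPiece (n : ℕ) (w : ℝ) (k : Fin n) : Set (Euc n) :=
  {x ∈ hillQ n w | (k.val : ℝ) * √(1 - w * ((n : ℝ) - 1)) ≤ ∑ i, x i ∧
    ∑ i, x i ≤ ((k.val : ℝ) + 1) * √(1 - w * ((n : ℝ) - 1))}

/-- The vertex `v_1 + ⋯ + v_k` (`0 ≤ k ≤ n`) of the standard `Q_n(w)`. -/
noncomputable def hillVertex (n : ℕ) (w : ℝ) (k : ℕ) : Euc n :=
  ∑ i : Fin n, if i.val < k then stdFrame n w i else 0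

/-- The half-turn of `ℝⁿ` (for `n = 3`: rotation by `π`) about the line through `a` and `b`, i.e.
the isometry that fixes the line pointwise and is `-1` orthogonally to it. -/
noncomputable def halfTurn {n : ℕ} (a b : Euc n) : Euc n ≃ᵃⁱ[ℝ] Euc n :=
  EuclideanGeometry.reflection (affineSpan ℝ {a, b})

/-- The placement of the three pieces of `Q_3(w)` in Schöbi's dissection (used for `n = 3`): with
the vertices `u_0, u_1, u_2, u_3` of `Q_3(w)`, the middle piece stays where it is, the piece
at `u_0` is turned about its edge from `u_1` to the midpoint of `u_0 u_2`, and the piece at `u_3` is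
turned about its edge from `u_2` to the midpoint of `u_1 u_3`. -/
noncomputable def schobiPiece (n : ℕ) (w : ℝ) (k : Fin n) : Set (Euc n) :=
  if k.val = 0 then
    halfTurn (hillVertex n w 1) (midpoint ℝ (hillVertex n w 0) (hillVertex n w 2)) '' hillPiece n w k
  else if k.val = 2 then
    halfTurn (hillVertex n w 2) (midpoint ℝ (hillVertex n w 1) (hillVertex n w 3)) '' hillPiece n w k
  else hillPiece n w k

/-!
A frame `v` with inner products `-w` gives linear coordinates `x ↦ ∑ x i • v i`, in which the
squared norm is a combination of `∑ x i ^ 2` and `(∑ x i) ^ 2`. Permutations and translations of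
the coordinates, even from one frame to another with the same `w`, are therefore isometries
(`exists_isometryEquiv_frameMap`).

The Hill simplex is `1 ≥ x 0 ≥ ⋯ ≥ x (n-1) ≥ 0`. It lies in the infinite cylinder
`x 0 ≥ ⋯ ≥ x (n-1) ≥ x 0 - 1`, which the screw motion `x ↦ (x 1, …, x (n-1), x 0 - 1)` preserves while it
lowers the coordinate sum by one. Both the simplex and the slab `0 ≤ ∑ x i ≤ 1` are fundamental
domains for the group generated by the screw motion. Explicitly, the `k`-th power of the motion
carries the slice `k ≤ ∑ x i ≤ k + 1` of the simplex onto the part of the slab where the last `k`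
coordinates are nonpositive and the others are nonnegative (`cyclicShift_mem_slabPiece_iff`), and
these parts dissect the slab. The slab is the prism: for the frame consisting of the vectors
`(c u₁, l), …, (c uₙ₋₁, l), (-c ∑ uᵢ, l)` it equals `c P × [0, l]` (`prism_smul_hillSimplex`).

In dimension three the two half-turns are, in coordinates, `x ↦ (1 - x 1, 1 - x 0, -x 2)` and
`x ↦ (2 - x 0, 1 - x 2, 1 - x 1)`, and the placed pieces dissect the slab `1 ≤ ∑ x i ≤ 2`, the image of
the prism under a screw motion.

That the slices are polytopes follows from two facts: a half-space cuts the hull of a finite set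
in the hull of a finite set (`IsFiniteHull.inter_halfSpace`), and the hull of a finite set that
spans the space affinely is the union of the nondegenerate simplices with vertices in the set
(`isPolytope_convexHull`).
-/

/-! ### Cutting finitely generated convex sets by half-spaces -/

/-- The point where the line through `p` and `q` meets the hyperplane `f = d`; it lies on the
segment from `p` to `q` when `d ≤ f p` and `f q < d`. -/
noncomputable def crossPoint {E : Type*} [AddCommGroup E] [Module ℝ E] (f : E →ₗ[ℝ] ℝ) (d : ℝ)
    (p q : E) : E :=
  ((f p - d) / (f p - f q)) • q + ((d - f q) / (f p - f q)) • p

/-- For `d ≤ f p` and `f q < d`, the crossing point is a convex function of either argument up to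
a projective change of weights, so it stays in a convex set that contains the crossing points
of all pairs of generators. -/
theorem crossPoint_mem_of_convexHull {E : Type*} [AddCommGroup E] [Module ℝ E] (f : E →ₗ[ℝ] ℝ)
    (d : ℝ) {A B V : Set E} (hV : Convex ℝ V) (hA : ∀ p ∈ A, d ≤ f p) (hB : ∀ q ∈ B, f q < d)
    (h : ∀ p ∈ A, ∀ q ∈ B, crossPoint f d p q ∈ V) {p q : E}
    (hp : p ∈ convexHull ℝ A) (hq : q ∈ convexHull ℝ B) : crossPoint f d p q ∈ V := by
  have h1 : ∀ p ∈ A, ∀ q ∈ convexHull ℝ B, f q < d ∧ crossPoint f d p q ∈ V := by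
    intro p hp q hq
    refine convexHull_min (t := {q | f q < d ∧ crossPoint f d p q ∈ V})
      (fun q hq => ⟨hB q hq, h p hp q hq⟩) ?_ hq
    rintro x ⟨hx, hx'⟩ y ⟨hy, hy'⟩ a b ha hb hab
    have hpd := hA p hp
    have hlt : f (a • x + b • y) < d := by
      have := (convex_halfSpace_lt f.isLinear d) hx hy ha hb hab
      exact this
    refine ⟨hlt, ?_⟩
    have e : f (a • x + b • y) = a * f x + b * f y := by simp
    rw [e] at hlt
    have hD : 0 < f p - (a * f x + b * f y) := by linarith
    have hDx : 0 < f p - f x := by linarith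
    have hDy : 0 < f p - f y := by linarith
    have := hV hx' hy' (a := a * (f p - f x) / (f p - (a * f x + b * f y)))
      (b := b * (f p - f y) / (f p - (a * f x + b * f y))) (by positivity) (by positivity)
      (by field_simp; linear_combination f p * hab)
    convert this using 1
    obtain rfl : b = 1 - a := by linarith
    simp only [crossPoint, e]
    match_scalars <;> field_simp
    ring
  have h2 : d ≤ f p ∧ ∀ q ∈ convexHull ℝ B, crossPoint f d p q ∈ V := by
    refine convexHull_min (t := {p | d ≤ f p ∧ ∀ q ∈ convexHull ℝ B, crossPoint f d p q ∈ V})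
      (fun p hp => ⟨hA p hp, fun q hq => (h1 p hp q hq).2⟩) ?_ hp
    rintro x ⟨hx, hx'⟩ y ⟨hy, hy'⟩ a b ha hb hab
    have hle : d ≤ f (a • x + b • y) := by
      have := (convex_halfSpace_ge f.isLinear d) hx hy ha hb hab
      exact this
    refine ⟨hle, fun q hq => ?_⟩
    have hqd : f q < d := convexHull_min (t := {q | f q < d}) hB
      (convex_halfSpace_lt f.isLinear d) hq
    have e : f (a • x + b • y) = a * f x + b * f y := by simp
    rw [e] at hle
    have hD : 0 < (a * f x + b * f y) - f q := by linarith
    have hDx : 0 < f x - f q := by linarith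
    have hDy : 0 < f y - f q := by linarith
    have := hV (hx' q hq) (hy' q hq) (a := a * (f x - f q) / ((a * f x + b * f y) - f q))
      (b := b * (f y - f q) / ((a * f x + b * f y) - f q)) (by positivity) (by positivity)
      (by field_simp; linear_combination -f q * hab)
    convert this using 1
    obtain rfl : b = 1 - a := by linarith
    simp only [crossPoint, e]
    match_scalars <;> field_simp
    ring
  exact h2.2 q hq

/-- Being the convex hull of a finite set. -/
def IsFiniteHull {E : Type*} [AddCommGroup E] [Module ℝ E] (K : Set E) : Prop :=
  ∃ S : Set E, S.Finite ∧ K = convexHull ℝ S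

/-- A half-space cuts the hull of a finite set `S` in the hull of the points of `S` in
the half-space and the crossing points of the segments with ends in `S`. -/
theorem IsFiniteHull.inter_halfSpace {E : Type*} [AddCommGroup E] [Module ℝ E] {K : Set E}
    (hK : IsFiniteHull K) (f : E →ₗ[ℝ] ℝ) (d : ℝ) : IsFiniteHull (K ∩ {x | d ≤ f x}) := by
  obtain ⟨S, hS, rfl⟩ := hK
  set A := {x ∈ S | d ≤ f x} with hA
  set B := {x ∈ S | f x < d} with hB
  have hAf : A.Finite := hS.subset fun x hx => hx.1
  have hBf : B.Finite := hS.subset fun x hx => hx.1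
  set C := Set.image2 (crossPoint f d) A B with hC
  have hcs : ∀ p q, d ≤ f p → f q < d →
      crossPoint f d p q ∈ segment ℝ p q ∧ f (crossPoint f d p q) = d := by
    intro p q hp hq
    have hD : 0 < f p - f q := by linarith
    refine ⟨⟨(d - f q) / (f p - f q), (f p - d) / (f p - f q),
      div_nonneg (by linarith) hD.le, div_nonneg (by linarith) hD.le, by field_simp; ring,
      by simp only [crossPoint]; abel⟩, ?_⟩
    simp only [crossPoint, map_add, map_smul, smul_eq_mul]
    field_simp
    ring
  refine ⟨A ∪ C, hAf.union (hAf.image2 _ hBf), ?_⟩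
  apply Set.Subset.antisymm
  · rintro x ⟨hx, hxd⟩
    have hSAB : S = A ∪ B := by
      ext y; simp only [hA, hB, Set.mem_union, Set.mem_ofPred_eq]
      constructor
      · intro hy; rcases le_or_gt d (f y) with h | h <;> simp [hy, h]
      · rintro (h | h) <;> exact h.1
    rcases B.eq_empty_or_nonempty with hBe | hBn
    · rw [hSAB, hBe, Set.union_empty] at hx
      exact convexHull_mono Set.subset_union_left hx
    rcases A.eq_empty_or_nonempty with hAe | hAn
    · rw [hSAB, hAe, Set.empty_union] at hx
      have : f x < d := convexHull_min (t := {q | f q < d}) (fun q hq => hq.2)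
        (convex_halfSpace_lt f.isLinear d) hx
      exact absurd hxd (not_le.2 this)
    rw [hSAB, convexHull_union hAn hBn, mem_convexJoin] at hx
    obtain ⟨p, hp, q, hq, a, b, ha, hb, hab, rfl⟩ := hx
    have hpd : d ≤ f p := convexHull_min (t := {q | d ≤ f q}) (fun q hq => hq.2)
      (convex_halfSpace_ge f.isLinear d) hp
    have hqd : f q < d := convexHull_min (t := {q | f q < d}) (fun q hq => hq.2)
      (convex_halfSpace_lt f.isLinear d) hq
    have hcV : crossPoint f d p q ∈ convexHull ℝ (A ∪ C) :=
      crossPoint_mem_of_convexHull f d (convex_convexHull ℝ _) (fun p hp => hp.2) (fun q hq => hq.2)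
        (fun p hp q hq => subset_convexHull ℝ _ (Or.inr ⟨p, hp, q, hq, rfl⟩)) hp hq
    have hpV : p ∈ convexHull ℝ (A ∪ C) := convexHull_mono Set.subset_union_left hp
    have hxd' : d ≤ a * f p + b * f q := by simpa using hxd
    obtain rfl : a = 1 - b := by linarith
    rcases hpd.eq_or_lt with hpe | hpe
    · have : b = 0 := by
        by_contra hne
        have : 0 < b := lt_of_le_of_ne hb (Ne.symm hne)
        nlinarith
      simpa [this] using hpV
    have hP : 0 < f p - d := by linarith
    have hD : 0 < f p - f q := by linarith
    -- `x` divides the segment from `p` to the crossing point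
    have := (convex_convexHull ℝ (A ∪ C)) hpV hcV (a := 1 - b * (f p - f q) / (f p - d))
      (b := b * (f p - f q) / (f p - d))
      (by rw [sub_nonneg, div_le_one hP]; nlinarith) (by positivity) (by ring)
    convert this using 1
    simp only [crossPoint]
    match_scalars <;> field_simp
    ring
  · refine convexHull_min ?_ ((convex_convexHull ℝ S).inter (convex_halfSpace_ge f.isLinear d))
    rintro x (hx | ⟨p, hp, q, hq, rfl⟩)
    · exact ⟨subset_convexHull ℝ _ hx.1, hx.2⟩
    · obtain ⟨h1, h2⟩ := hcs p q hp.2 hq.2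
      exact ⟨segment_subset_convexHull hp.1 hq.1 h1, h2.ge⟩

theorem IsFiniteHull.inter_iInter_halfSpace {E ι : Type*} [AddCommGroup E] [Module ℝ E] [Finite ι]
    {K : Set E} (hK : IsFiniteHull K) (f : ι → E →ₗ[ℝ] ℝ) (d : ι → ℝ) :
    IsFiniteHull (K ∩ {x | ∀ i, d i ≤ f i x}) := by
  classical
  have := Fintype.ofFinite ι
  suffices ∀ s : Finset ι, IsFiniteHull (K ∩ {x | ∀ i ∈ s, d i ≤ f i x}) by
    simpa using this Finset.univ
  intro s
  induction s using Finset.induction_on with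
  | empty => simpa using hK
  | insert i s _ ih =>
    convert ih.inter_halfSpace (f i) (d i) using 1
    ext x
    simp only [Finset.forall_mem_insert, Set.mem_inter_iff, Set.mem_ofPred_eq]
    tauto

theorem IsFiniteHull.image {E F : Type*} [AddCommGroup E] [Module ℝ E] [AddCommGroup F]
    [Module ℝ F] {K : Set E} (hK : IsFiniteHull K) (g : E →ₗ[ℝ] F) : IsFiniteHull (g '' K) := by
  obtain ⟨S, hS, rfl⟩ := hK
  exact ⟨g '' S, hS.image _, g.image_convexHull S⟩

theorem isFiniteHull_Icc_zero_one {ι : Type*} [Finite ι] :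
    IsFiniteHull {x : ι → ℝ | ∀ i, 0 ≤ x i ∧ x i ≤ 1} := by
  refine ⟨Set.univ.pi fun _ => {0, 1}, Set.Finite.pi fun _ => by simp, ?_⟩
  rw [convexHull_pi]
  ext x
  simp [convexHull_pair, segment_eq_Icc, Pi.le_def, forall_and]

/-! ### Polytopes -/

/-- An affinely independent subset of a spanning set extends to an affine basis inside it. -/
theorem exists_affineIndependent_between {E : Type*} [AddCommGroup E] [Module ℝ E] {S t : Set E}
    (hS : S.Finite) (hspan : affineSpan ℝ S = ⊤) (hts : t ⊆ S)
    (ht : AffineIndependent ℝ ((↑) : t → E)) :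
    ∃ b : Set E, t ⊆ b ∧ b ⊆ S ∧ AffineIndependent ℝ ((↑) : b → E) ∧ affineSpan ℝ b = ⊤ := by
  have hfin : {b : Set E | t ⊆ b ∧ b ⊆ S ∧ AffineIndependent ℝ ((↑) : b → E)}.Finite :=
    hS.finite_subsets.subset fun b hb => hb.2.1
  obtain ⟨b, -, hb⟩ := hfin.exists_le_maximal (a := t) ⟨subset_rfl, hts, ht⟩
  obtain ⟨⟨h1, h2, h3⟩, hmax⟩ := hb
  refine ⟨b, h1, h2, h3, ?_⟩
  rw [eq_top_iff, ← hspan, affineSpan_le]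
  intro x hx
  by_contra hxb
  have hxb' : x ∉ b := fun h => hxb (subset_affineSpan ℝ b h)
  have hins : AffineIndependent ℝ ((↑) : ↥(insert x b) → E) := by
    refine AffineIndependent.affineIndependent_of_notMem_span (i := ⟨x, Set.mem_insert x b⟩) ?_ ?_
    · let e : {y : ↥(insert x b) // y ≠ ⟨x, Set.mem_insert x b⟩} ↪ b :=
        ⟨fun y => ⟨y.1.1, (Set.mem_insert_iff.1 y.1.2).resolve_left
          fun h => y.2 (Subtype.ext h)⟩, fun y z h => by
            apply Subtype.ext; apply Subtype.ext; simpa using h⟩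
      exact h3.comp_embedding e
    · suffices h : ((↑) : ↥(insert x b) → E) '' {y | y ≠ ⟨x, Set.mem_insert x b⟩} = b by
        rw [h]; exact hxb
      ext y
      simp only [Set.mem_image, Set.mem_ofPred_eq]
      constructor
      · rintro ⟨z, hz, rfl⟩
        exact (Set.mem_insert_iff.1 z.2).resolve_left fun h => hz (Subtype.ext h)
      · intro hy
        exact ⟨⟨y, Set.mem_insert_of_mem _ hy⟩, fun h => hxb' (by
          have := congrArg Subtype.val h; simp only at this; rwa [← this]), rfl⟩
  have := hmax (y := insert x b) ⟨h1.trans (Set.subset_insert _ _),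
    Set.insert_subset hx h2, hins⟩ (Set.subset_insert _ _)
  exact hxb' (this (Set.mem_insert _ _))

/-- The hull of a finite set that spans affinely is a polytope: by Carathéodory's theorem, it is the
union of the nondegenerate simplices with vertices in this set. -/
theorem isPolytope_convexHull {n : ℕ} {S : Set (Euc n)} (hS : S.Finite)
    (hspan : affineSpan ℝ S = ⊤) : IsPolytope (convexHull ℝ S) := by
  let T := {s : Affine.Simplex ℝ (Euc n) n // Set.range s.points ⊆ S}
  have hcover : ∀ t : Set (Euc n), t ⊆ S → AffineIndependent ℝ ((↑) : t → Euc n) →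
      ∃ s : T, convexHull ℝ t ⊆ convexHull ℝ (Set.range s.1.points) := by
    intro t hts ht
    obtain ⟨b, htb, hbS, hb, hbt⟩ := exists_affineIndependent_between hS hspan hts ht
    have : Fintype b := (hS.subset hbS).fintype
    have hcard : Fintype.card b = n + 1 := by
      have := hb.affineSpan_eq_top_iff_card_eq_finrank_add_one.1 (by simpa using hbt)
      simpa using this
    let e : Fin (n + 1) ≃ b := (Fintype.equivFinOfCardEq hcard).symm
    have hr : Set.range (fun i => (e i : Euc n)) = b := by
      have := e.surjective.range_comp ((↑) : b → Euc n)
      rw [Subtype.range_coe] at this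
      exact this
    refine ⟨⟨⟨fun i => e i, hb.comp_embedding e.toEmbedding⟩, hr.le.trans hbS⟩, ?_⟩
    exact convexHull_mono (htb.trans hr.ge)
  have hTf : Finite T := by
    have := hS.to_subtype
    refine Finite.of_injective (β := Fin (n + 1) → S)
      (fun s i => ⟨s.1.points i, s.2 (Set.mem_range_self i)⟩) fun s t h => ?_
    apply Subtype.ext
    ext i : 1
    have := congrFun h i
    simpa using this
  have hTn : Nonempty T := by
    obtain ⟨s, -⟩ := hcover ∅ (Set.empty_subset _) (affineIndependent_of_subsingleton ℝ _)
    exact ⟨s⟩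
  obtain ⟨m, ⟨e⟩⟩ := Finite.exists_equiv_fin T
  obtain ⟨k, rfl⟩ : ∃ k, m = k + 1 :=
    Nat.exists_eq_succ_of_ne_zero (by rintro rfl; exact (e hTn.some).elim0)
  refine ⟨k, fun i => (e.symm i).1, Set.Subset.antisymm ?_ ?_⟩
  · rw [convexHull_eq_union]
    intro x hx
    simp only [Set.mem_iUnion] at hx ⊢
    obtain ⟨t, hts, ht, hxt⟩ := hx
    obtain ⟨s, hs⟩ := hcover t hts ht
    exact ⟨e s, by simpa using hs hxt⟩
  · exact Set.iUnion_subset fun i => convexHull_mono (e.symm i).2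

theorem IsFiniteHull.isPolytope {n : ℕ} {K : Set (Euc n)} (hK : IsFiniteHull K)
    (hi : (interior K).Nonempty) : IsPolytope K := by
  obtain ⟨S, hS, rfl⟩ := hK
  refine isPolytope_convexHull hS ?_
  rw [eq_top_iff, ← affineSpan_convexHull, ← isOpen_interior.affineSpan_eq_top hi]
  exact affineSpan_mono ℝ interior_subset

theorem IsPolytope.image {n : ℕ} {P : Set (Euc n)} (hP : IsPolytope P) (g : Euc n ≃ᵢ Euc n) :
    IsPolytope (g '' P) := by
  obtain ⟨k, s, rfl⟩ := hP
  let a : Euc n →ᵃ[ℝ] Euc n := g.toRealAffineIsometryEquiv.toAffineEquiv.toAffineMap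
  have ha : Function.Injective a := g.injective
  refine ⟨k, fun i => (s i).map a ha, ?_⟩
  rw [Set.image_iUnion]
  refine Set.iUnion_congr fun i => ?_
  have := a.image_convexHull (Set.range (s i).points)
  simp only [Affine.Simplex.map_points, Set.range_comp]
  exact this

/-! ### Coordinates with respect to a Hill frame -/

/-- The linear map that takes a coordinate vector `x` to `∑ i, x i • v i`. -/
noncomputable def frameMap {n : ℕ} (v : Fin n → Euc n) : (Fin n → ℝ) →ₗ[ℝ] Euc n :=
  Fintype.linearCombination ℝ v

theorem frameMap_apply {n : ℕ} (v : Fin n → Euc n) (x : Fin n → ℝ) :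
    frameMap v x = ∑ i, x i • v i :=
  Fintype.linearCombination_apply ℝ v x

theorem IsHillFrame.inner_frameMap {n : ℕ} {w : ℝ} {v : Fin n → Euc n} (hv : IsHillFrame w v)
    (x y : Fin n → ℝ) :
    ⟪frameMap v x, frameMap v y⟫ = (1 + w) * ∑ i, x i * y i - w * ((∑ i, x i) * ∑ i, y i) := by
  have hg : ∀ i j, ⟪v i, v j⟫ = (if i = j then 1 + w else 0) - w := by
    intro i j
    split_ifs with h
    · subst h
      rw [real_inner_self_eq_norm_sq, hv.1 i]; ring
    · rw [hv.2 i j h]; ring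
  simp only [frameMap_apply, sum_inner, inner_sum, real_inner_smul_left, real_inner_smul_right, hg,
    mul_sub, mul_ite, mul_zero, Finset.sum_sub_distrib, Finset.mul_sum, Finset.sum_mul]
  rw [Finset.sum_comm]
  congr 1
  · refine Finset.sum_congr rfl fun i _ => ?_
    simp only [Finset.sum_ite_eq, Finset.mem_univ, if_true]
    ring
  · exact Finset.sum_congr rfl fun i _ => Finset.sum_congr rfl fun j _ => by ring

theorem IsHillFrame.norm_frameMap_sq {n : ℕ} {w : ℝ} {v : Fin n → Euc n} (hv : IsHillFrame w v)
    (x : Fin n → ℝ) :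
    ‖frameMap v x‖ ^ 2 = (1 + w) * ∑ i, x i ^ 2 - w * (∑ i, x i) ^ 2 := by
  rw [← real_inner_self_eq_norm_sq, hv.inner_frameMap]
  simp only [sq]

theorem IsHillFrame.frameMap_injective {n : ℕ} {w : ℝ} {v : Fin n → Euc n} (hv : IsHillFrame w v)
    (h₁ : 0 < 1 + w) (h₂ : 0 < 1 - w * ((n : ℝ) - 1)) : Function.Injective (frameMap v) := by
  rw [← LinearMap.ker_eq_bot, LinearMap.ker_eq_bot']
  intro x hx
  have hj : ∀ j, (1 + w) * x j - w * ∑ i, x i = 0 := by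
    intro j
    have := hv.inner_frameMap x (Pi.single j 1)
    rw [hx, inner_zero_left] at this
    simpa [Pi.single_apply] using this.symm
  have hs : (1 - w * ((n : ℝ) - 1)) * ∑ i, x i = 0 := by
    have : ∑ j, ((1 + w) * x j - w * ∑ i, x i) = 0 := Finset.sum_eq_zero fun j _ => hj j
    rw [Finset.sum_sub_distrib, ← Finset.mul_sum, Finset.sum_const, Finset.card_univ,
      Fintype.card_fin, nsmul_eq_mul] at this
    linear_combination this
  have hs0 := (mul_eq_zero.1 hs).resolve_left h₂.ne'
  ext j
  have := hj j
  rw [hs0, mul_zero, sub_zero] at this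
  exact (mul_eq_zero.1 this).resolve_left h₁.ne'

/-- The coordinates of a Hill frame, as a linear equivalence. -/
noncomputable def IsHillFrame.equiv {n : ℕ} {w : ℝ} {v : Fin n → Euc n} (hv : IsHillFrame w v)
    (h₁ : 0 < 1 + w) (h₂ : 0 < 1 - w * ((n : ℝ) - 1)) : (Fin n → ℝ) ≃ₗ[ℝ] Euc n :=
  LinearEquiv.ofInjectiveOfFinrankEq (frameMap v) (hv.frameMap_injective h₁ h₂) (by simp)

theorem IsHillFrame.equiv_apply {n : ℕ} {w : ℝ} {v : Fin n → Euc n} (hv : IsHillFrame w v)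
    (h₁ : 0 < 1 + w) (h₂ : 0 < 1 - w * ((n : ℝ) - 1)) (x : Fin n → ℝ) :
    hv.equiv h₁ h₂ x = frameMap v x := rfl

/-- The Gram matrix of a Hill frame depends only on `w` and is invariant under permutations. Hence
permutations and translations of the coordinates, from one frame to another, are isometries. -/
theorem exists_isometryEquiv_frameMap {n : ℕ} {w : ℝ} {v v' : Fin n → Euc n}
    (hv : IsHillFrame w v) (hv' : IsHillFrame w v') (h₁ : 0 < 1 + w)
    (h₂ : 0 < 1 - w * ((n : ℝ) - 1)) (σ : Equiv.Perm (Fin n)) (t : Fin n → ℝ) :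
    ∃ g : Euc n ≃ᵢ Euc n, ∀ x, g (frameMap v x) = frameMap v' fun i => x (σ i) + t (σ i) := by
  let e : (Fin n → ℝ) ≃ (Fin n → ℝ) :=
    (Equiv.addRight t).trans (Equiv.arrowCongr σ.symm (Equiv.refl ℝ))
  have he : ∀ x, e x = fun i => x (σ i) + t (σ i) := fun x => rfl
  let E : Euc n ≃ Euc n :=
    ((hv.equiv h₁ h₂).symm.toEquiv.trans e).trans (hv'.equiv h₁ h₂).toEquiv
  have hE : ∀ x, E (frameMap v x) = frameMap v' fun i => x (σ i) + t (σ i) := by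
    intro x
    rw [← hv.equiv_apply h₁ h₂, ← hv'.equiv_apply h₁ h₂, ← he]
    simp [E]
  refine ⟨⟨E, Isometry.of_dist_eq fun p q => ?_⟩, hE⟩
  obtain ⟨x, rfl⟩ := (hv.equiv h₁ h₂).surjective p
  obtain ⟨y, rfl⟩ := (hv.equiv h₁ h₂).surjective q
  rw [hv.equiv_apply, hv.equiv_apply]
  change dist (E _) (E _) = _
  rw [hE, hE, dist_eq_norm, dist_eq_norm, ← map_sub, ← map_sub,
    ← sq_eq_sq₀ (norm_nonneg _) (norm_nonneg _), hv.norm_frameMap_sq, hv'.norm_frameMap_sq]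
  have e1 : ∀ i, ((fun i => x (σ i) + t (σ i)) - fun i => y (σ i) + t (σ i)) i = (x - y) (σ i) := by
    intro i
    simp
  simp only [e1]
  rw [Equiv.sum_comp σ (x - y), Equiv.sum_comp σ fun i => (x - y) i ^ 2]

/-- Sets on different sides of a hyperplane have disjoint interiors. -/
theorem IsHillFrame.disjoint_interior {n : ℕ} {w : ℝ} {v : Fin n → Euc n}
    (hv : IsHillFrame w v) (h₁ : 0 < 1 + w) (h₂ : 0 < 1 - w * ((n : ℝ) - 1))
    (f : (Fin n → ℝ) →ₗ[ℝ] ℝ) (hf : f ≠ 0) (d : ℝ) {S T : Set (Fin n → ℝ)}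
    (hS : ∀ x ∈ S, f x ≤ d) (hT : ∀ x ∈ T, d ≤ f x) :
    Disjoint (interior (frameMap v '' S)) (interior (frameMap v '' T)) := by
  rw [Set.disjoint_iff_inter_eq_empty, Set.eq_empty_iff_forall_notMem]
  intro p hp
  let F : Euc n →ₗ[ℝ] ℝ := f ∘ₗ (hv.equiv h₁ h₂).symm.toLinearMap
  have hF : ∀ x, F (frameMap v x) = f x := by
    intro x
    rw [← hv.equiv_apply h₁ h₂]
    simp [F]
  have hsurj : Function.Surjective F := by
    apply LinearMap.surjective
    rintro h0
    apply hf
    refine LinearMap.ext fun x => ?_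
    rw [← hF, h0, LinearMap.zero_apply, LinearMap.zero_apply]
  have hopen := LinearMap.isOpenMap_of_finiteDimensional F hsurj _
    ((isOpen_interior (s := frameMap v '' S)).inter (isOpen_interior (s := frameMap v '' T)))
  have hsub : F '' (interior (frameMap v '' S) ∩ interior (frameMap v '' T)) ⊆ {d} := by
    rintro _ ⟨q, ⟨hq, hq'⟩, rfl⟩
    obtain ⟨x, hx, hxq⟩ := interior_subset hq
    obtain ⟨y, hy, rfl⟩ := interior_subset hq'
    have := hv.frameMap_injective h₁ h₂ hxq
    subst this
    rw [hF]
    exact le_antisymm (hS _ hx) (hT _ hy)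
  have := interior_mono hsub
  rw [hopen.interior_eq, interior_singleton] at this
  exact this ⟨p, hp, rfl⟩

/-- A part of the unit cube cut out by finitely many half-spaces gives a polytope if some point
satisfies all inequalities strictly. -/
theorem IsHillFrame.isPolytope_image {n : ℕ} {w : ℝ} {v : Fin n → Euc n} {ι : Type*} [Finite ι]
    (hv : IsHillFrame w v) (h₁ : 0 < 1 + w) (h₂ : 0 < 1 - w * ((n : ℝ) - 1))
    (f : ι → (Fin n → ℝ) →ₗ[ℝ] ℝ) (d : ι → ℝ) (x₀ : Fin n → ℝ) (hx₀ : ∀ i, 0 < x₀ i ∧ x₀ i < 1)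
    (hfx₀ : ∀ i, d i < f i x₀) :
    IsPolytope (frameMap v '' ({x | ∀ i, 0 ≤ x i ∧ x i ≤ 1} ∩ {x | ∀ i, d i ≤ f i x})) := by
  refine ((isFiniteHull_Icc_zero_one.inter_iInter_halfSpace f d).image _).isPolytope ?_
  let U : Set (Fin n → ℝ) := {x | ∀ i, 0 < x i ∧ x i < 1} ∩ {x | ∀ i, d i < f i x}
  have hU : IsOpen U := by
    have h1 : U = (⋂ i, {x | 0 < x i} ∩ {x | x i < 1}) ∩ ⋂ i, {x | d i < f i x} := by
      ext x; simp [U]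
    rw [h1]
    refine (isOpen_iInter_of_finite fun i => ?_).inter (isOpen_iInter_of_finite fun i => ?_)
    · exact (isOpen_lt continuous_const (continuous_apply i)).inter
        (isOpen_lt (continuous_apply i) continuous_const)
    · exact isOpen_lt continuous_const (f i).continuous_of_finiteDimensional
  have hopen := LinearMap.isOpenMap_of_finiteDimensional (frameMap v)
    (hv.equiv h₁ h₂).surjective _ hU
  have hsub : frameMap v '' U ⊆
      frameMap v '' ({x | ∀ i, 0 ≤ x i ∧ x i ≤ 1} ∩ {x | ∀ i, d i ≤ f i x}) :=
    Set.image_mono fun x hx =>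
      ⟨fun i => ⟨(hx.1 i).1.le, (hx.1 i).2.le⟩, fun i => (hx.2 i).le⟩
  exact ⟨frameMap v x₀, interior_maximal hsub hopen ⟨x₀, ⟨hx₀, hfx₀⟩, rfl⟩⟩

/-! ### The cyclic shift in coordinates -/

/-- The coordinates of the points of the Hill simplex with `k ≤ ∑ x i ≤ k + 1`. -/
def simplexSlice (n : ℕ) (k : ℝ) : Set (Fin n → ℝ) :=
  {x | Antitone x ∧ (∀ i, 0 ≤ x i ∧ x i ≤ 1) ∧ k ≤ ∑ i, x i ∧ ∑ i, x i ≤ k + 1}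

/-- The slab `a ≤ ∑ x i ≤ a + 1` of the infinite cylinder
`x 0 ≥ x 1 ≥ ⋯ ≥ x (n - 1) ≥ x 0 - 1`, in coordinates. -/
def cylinderSlab (n : ℕ) (a : ℝ) : Set (Fin n → ℝ) :=
  {x | Antitone x ∧ (∀ i j, x i - 1 ≤ x j) ∧ a ≤ ∑ i, x i ∧ ∑ i, x i ≤ a + 1}

/-- The part of the slab `0 ≤ ∑ x i ≤ 1` of the cylinder where the last `k` coordinates are
nonpositive and the other ones nonnegative. -/
def slabPiece (n k : ℕ) : Set (Fin n → ℝ) :=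
  {x ∈ cylinderSlab n 0 | ∀ i : Fin n, (i.val + k < n → 0 ≤ x i) ∧ (n ≤ i.val + k → x i ≤ 0)}

/-- The `k`-th power of the screw motion `x ↦ (x 1, …, x (n-1), x 0 - 1)` of the cylinder, which
lowers the coordinate sum by `k`. -/
def cyclicShift {n : ℕ} (k : Fin n) (x : Fin n → ℝ) (i : Fin n) : ℝ :=
  x (i + k) + if (i + k).val < k.val then -1 else 0

theorem cyclicShift_apply_of_lt {n : ℕ} (k : Fin n) (x : Fin n → ℝ) (i : Fin n)
    (h : i.val + k.val < n) : cyclicShift k x i = x ⟨i.val + k.val, h⟩ := by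
  have e : i + k = ⟨i.val + k.val, h⟩ := Fin.ext (by rw [Fin.val_add_eq_ite, if_neg (by lia)])
  simp [cyclicShift, e]

theorem cyclicShift_apply_of_ge {n : ℕ} (k : Fin n) (x : Fin n → ℝ) (i : Fin n)
    (h : n ≤ i.val + k.val) : cyclicShift k x i = x ⟨i.val + k.val - n, by lia⟩ - 1 := by
  have e : i + k = ⟨i.val + k.val - n, by lia⟩ :=
    Fin.ext (by rw [Fin.val_add_eq_ite, if_pos h])
  have hlt : i.val + k.val - n < k.val := by lia
  simp [cyclicShift, e, hlt, sub_eq_add_neg]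

theorem sum_cyclicShift {n : ℕ} (k : Fin n) (x : Fin n → ℝ) :
    ∑ i, cyclicShift k x i = ∑ i, x i - k.val := by
  have : NeZero n := ⟨by have := k.2; lia⟩
  have h := Equiv.sum_comp (Equiv.addRight k) fun j : Fin n => x j + if j.val < k.val then -1 else 0
  have hcard : (Finset.univ.filter fun j : Fin n => j.val < k.val).card = k.val := by
    have : (Finset.univ.filter fun j : Fin n => j.val < k.val) = Finset.Iio k := by
      ext j; simp
    rw [this, Fin.card_Iio]
  refine h.trans ?_
  rw [Finset.sum_add_distrib, ← Finset.sum_filter, Finset.sum_const, hcard, nsmul_eq_mul]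
  ring

theorem cyclicShift_bijective {n : ℕ} (k : Fin n) : Function.Bijective (cyclicShift k) := by
  have : NeZero n := ⟨by have := k.2; lia⟩
  exact ((Equiv.addRight fun j : Fin n => if j.val < k.val then (-1 : ℝ) else 0).trans
    (Equiv.arrowCongr (Equiv.addRight k).symm (Equiv.refl ℝ))).bijective

/-- The shift turns the chain `1 ≥ x 0 ≥ ⋯ ≥ x (n-1) ≥ 0` into the cylinder conditions together with
the sign change after the first `n - k` coordinates. -/
theorem cyclicShift_mem_slabPiece_iff {n : ℕ} (k : Fin n) (x : Fin n → ℝ) :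
    cyclicShift k x ∈ slabPiece n k ↔ x ∈ simplexSlice n k.val := by
  have hlt := cyclicShift_apply_of_lt k x
  have hge := cyclicShift_apply_of_ge k x
  have hsum := sum_cyclicShift k x
  set y := cyclicShift k x
  have hk := k.2
  constructor
  · rintro ⟨⟨ha, hc, hs0, hs1⟩, hsg⟩
    have hx1 : ∀ p : Fin n, k.val ≤ p.val → ∃ i : Fin n, i.val = p.val - k.val ∧ y i = x p := by
      intro p hp
      refine ⟨⟨p.val - k.val, by lia⟩, rfl, ?_⟩
      rw [hlt _ (by simp only; lia)]
      congr 1; ext; simp only; lia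
    have hx2 : ∀ p : Fin n, p.val < k.val →
        ∃ i : Fin n, i.val = p.val + n - k.val ∧ y i = x p - 1 := by
      intro p hp
      refine ⟨⟨p.val + n - k.val, by lia⟩, rfl, ?_⟩
      rw [hge _ (by simp only; lia)]
      congr 2; ext; simp only; lia
    refine ⟨?_, ?_, by linarith, by linarith⟩
    · intro p q hpq
      have hpq' : p.val ≤ q.val := hpq
      rcases lt_or_ge p.val k.val with hp | hp <;> rcases lt_or_ge q.val k.val with hq | hq
      · obtain ⟨i, hi, hi'⟩ := hx2 p hp
        obtain ⟨j, hj, hj'⟩ := hx2 q hq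
        have := ha (show i ≤ j by rw [Fin.le_def]; lia)
        linarith
      · obtain ⟨i, hi, hi'⟩ := hx2 p hp
        obtain ⟨j, hj, hj'⟩ := hx1 q hq
        have := hc j i
        linarith
      · lia
      · obtain ⟨i, hi, hi'⟩ := hx1 p hp
        obtain ⟨j, hj, hj'⟩ := hx1 q hq
        have := ha (show i ≤ j by rw [Fin.le_def]; lia)
        linarith
    · intro p
      rcases lt_or_ge p.val k.val with hp | hp
      · obtain ⟨i, hi, hi'⟩ := hx2 p hp
        have h1 := (hsg i).2 (by lia)
        have h2 := hc ⟨0, by lia⟩ i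
        have h3 := (hsg ⟨0, by lia⟩).1 (by simp only; lia)
        constructor <;> linarith
      · obtain ⟨i, hi, hi'⟩ := hx1 p hp
        have h1 := (hsg i).1 (by lia)
        refine ⟨by linarith, ?_⟩
        rcases Nat.eq_zero_or_pos k.val with h0 | h0
        · -- for `k = 0` all coordinates are nonnegative, and their sum is at most `1`
          have := Finset.single_le_sum (f := y) (fun j _ => (hsg j).1 (by lia)) (Finset.mem_univ i)
          linarith
        · have h2 := (hsg ⟨n - 1, by lia⟩).2 (by simp only; lia)
          have h3 := hc i ⟨n - 1, by lia⟩
          linarith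
  · rintro ⟨ha, hb, hs0, hs1⟩
    refine ⟨⟨?_, ?_, by linarith, by linarith⟩, fun i => ⟨fun h => ?_, fun h => ?_⟩⟩
    · intro i j hij
      have hij' : i.val ≤ j.val := hij
      rcases lt_or_ge (i.val + k.val) n with hi | hi <;>
        rcases lt_or_ge (j.val + k.val) n with hj | hj
      · rw [hlt i hi, hlt j hj]
        exact ha (by rw [Fin.le_def]; simp only; lia)
      · rw [hlt i hi, hge j hj]
        have h1 := hb ⟨i.val + k.val, hi⟩
        have h2 := hb ⟨j.val + k.val - n, by lia⟩
        linarith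
      · lia
      · rw [hge i hi, hge j hj]
        have : x ⟨j.val + k.val - n, by lia⟩ ≤ x ⟨i.val + k.val - n, by lia⟩ :=
          ha (by rw [Fin.le_def]; simp only; lia)
        linarith
    · intro i j
      rcases lt_or_ge (i.val + k.val) n with hi | hi <;>
        rcases lt_or_ge (j.val + k.val) n with hj | hj
      · rw [hlt i hi, hlt j hj]
        have h1 := hb ⟨i.val + k.val, hi⟩
        have h2 := hb ⟨j.val + k.val, hj⟩
        linarith
      · rw [hlt i hi, hge j hj]
        have : x ⟨i.val + k.val, hi⟩ ≤ x ⟨j.val + k.val - n, by lia⟩ :=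
          ha (by rw [Fin.le_def]; simp only; lia)
        linarith
      · rw [hge i hi, hlt j hj]
        have h1 := hb ⟨i.val + k.val - n, by lia⟩
        have h2 := hb ⟨j.val + k.val, hj⟩
        linarith
      · rw [hge i hi, hge j hj]
        have h1 := hb ⟨i.val + k.val - n, by lia⟩
        have h2 := hb ⟨j.val + k.val - n, by lia⟩
        linarith
    · rw [hlt i h]
      exact (hb _).1
    · rw [hge i h]
      linarith [(hb ⟨i.val + k.val - n, by lia⟩).2]

theorem image_cyclicShift_simplexSlice {n : ℕ} (k : Fin n) :
    cyclicShift k '' simplexSlice n k.val = slabPiece n k := by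
  ext y
  constructor
  · rintro ⟨x, hx, rfl⟩
    exact (cyclicShift_mem_slabPiece_iff k x).2 hx
  · intro hy
    obtain ⟨x, rfl⟩ := (cyclicShift_bijective k).2 y
    exact ⟨x, (cyclicShift_mem_slabPiece_iff k x).1 hy, rfl⟩

/-- The pieces are told apart by the number of nonnegative coordinates, which is positive because
the coordinate sum is nonnegative. -/
theorem cylinderSlab_zero_eq_iUnion {n : ℕ} (hn : 0 < n) :
    cylinderSlab n 0 = ⋃ k : Fin n, slabPiece n k := by
  apply Set.Subset.antisymm
  · intro x hx
    obtain ⟨ha, hc, hs0, hs1⟩ := hx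
    have hne : {i | 0 ≤ x i}.Nonempty := by
      by_contra h
      have hneg : ∀ i, x i < 0 := fun i => not_le.1 fun hi => h ⟨i, hi⟩
      have : ∑ i, x i < 0 := Finset.sum_neg (fun i _ => hneg i) ⟨⟨0, hn⟩, Finset.mem_univ _⟩
      linarith
    obtain ⟨m, hm, hmax⟩ := (Set.toFinite {i | 0 ≤ x i}).exists_maximal hne
    have hm0 : 0 ≤ x m := hm
    have hmn := m.2
    -- `m` is the last index of a nonnegative coordinate
    refine Set.mem_iUnion.2 ⟨⟨n - 1 - m.val, by lia⟩, ⟨ha, hc, hs0, hs1⟩, fun i =>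
      ⟨fun h => ?_, fun h => ?_⟩⟩
    · simp only at h
      exact hm0.trans (ha (show i ≤ m by rw [Fin.le_def]; lia))
    · simp only at h
      by_contra hi
      have : i ≤ m := hmax (y := i) (not_le.1 hi).le ((show m ≤ i by rw [Fin.le_def]; lia))
      rw [Fin.le_def] at this
      lia
  · exact Set.iUnion_subset fun k x hx => hx.1

theorem iUnion_simplexSlice {n : ℕ} (hn : 0 < n) :
    {x : Fin n → ℝ | Antitone x ∧ ∀ i, 0 ≤ x i ∧ x i ≤ 1} =
      ⋃ k : Fin n, simplexSlice n k.val := by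
  apply Set.Subset.antisymm
  · rintro x ⟨ha, hb⟩
    have h0 : 0 ≤ ∑ i, x i := Finset.sum_nonneg fun i _ => (hb i).1
    have h1 : ∑ i, x i ≤ n := by
      have := Finset.sum_le_card_nsmul Finset.univ x 1 fun i _ => (hb i).2
      simpa using this
    refine Set.mem_iUnion.2 ?_
    rcases h1.eq_or_lt with h | h
    · refine ⟨⟨n - 1, by lia⟩, ha, hb, ?_, ?_⟩ <;>
        simp only [Nat.cast_sub (show 1 ≤ n from hn), Nat.cast_one] <;> linarith
    · refine ⟨⟨⌊∑ i, x i⌋₊, (Nat.floor_lt h0).2 h⟩, ha, hb, Nat.floor_le h0,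
        (Nat.lt_floor_add_one _).le⟩
  · exact Set.iUnion_subset fun k x hx => ⟨hx.1, hx.2.1⟩

/-! ### The dissections in coordinates -/

theorem coordSum_ne_zero {n : ℕ} (hn : 0 < n) :
    (∑ i, LinearMap.proj i : (Fin n → ℝ) →ₗ[ℝ] ℝ) ≠ 0 := by
  intro h
  have := LinearMap.congr_fun h fun _ => 1
  simp at this
  lia

theorem coordProj_ne_zero {n : ℕ} (i : Fin n) :
    (LinearMap.proj i : (Fin n → ℝ) →ₗ[ℝ] ℝ) ≠ 0 := by
  intro h
  have := LinearMap.congr_fun h fun _ => 1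
  simp at this

theorem IsHillFrame.isPolytope_simplexSlice {n : ℕ} {w : ℝ} {v : Fin n → Euc n}
    (hv : IsHillFrame w v) (h₁ : 0 < 1 + w) (h₂ : 0 < 1 - w * ((n : ℝ) - 1)) (k : Fin n) :
    IsPolytope (frameMap v '' simplexSlice n k.val) := by
  have hn : 0 < n := k.pos
  have hn' : (1 : ℝ) ≤ n := by exact_mod_cast hn
  let sumL : (Fin n → ℝ) →ₗ[ℝ] ℝ := ∑ i, LinearMap.proj i
  have hsumL : ∀ x, sumL x = ∑ i, x i := fun x => by simp [sumL]
  let f : {p : Fin n × Fin n // p.1 < p.2} ⊕ Bool → (Fin n → ℝ) →ₗ[ℝ] ℝ :=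
    Sum.elim (fun p => (LinearMap.proj p.1.1 : (Fin n → ℝ) →ₗ[ℝ] ℝ) - LinearMap.proj p.1.2)
      fun b => if b then sumL else -sumL
  let d : {p : Fin n × Fin n // p.1 < p.2} ⊕ Bool → ℝ :=
    Sum.elim (fun _ => 0) fun b => if b then (k.val : ℝ) else -(k.val + 1)
  -- a strictly decreasing sequence near the constant one with sum `k + 1/2`
  let x₀ : Fin n → ℝ := fun i => (k.val + 1 / 2) / n + ((n - 1) / 2 - i.val) / (2 * n ^ 2)
  have hi : ∀ i : Fin n, (i.val : ℝ) ≤ n - 1 := by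
    intro i
    have : i.val + 1 ≤ n := i.2
    have : ((i.val + 1 : ℕ) : ℝ) ≤ n := by exact_mod_cast this
    push_cast at this; linarith
  have hsum₀ : ∑ i, x₀ i = k.val + 1 / 2 := by
    have hg : (∑ i : Fin n, (i.val : ℝ)) = n * (n - 1) / 2 := by
      rw [Fin.sum_univ_eq_sum_range fun i => (i : ℝ)]
      have := Finset.sum_range_id_mul_two n
      have h' : ((∑ i ∈ Finset.range n, i : ℕ) : ℝ) * 2 = n * (n - 1) := by
        have := congrArg (Nat.cast (R := ℝ)) this
        push_cast [Nat.cast_sub (show 1 ≤ n from hn)] at this ⊢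
        linarith
      push_cast at h'
      linarith
    simp only [x₀, Finset.sum_add_distrib, ← Finset.sum_div, Finset.sum_sub_distrib, hg,
      Finset.sum_const, Finset.card_univ, Fintype.card_fin, nsmul_eq_mul]
    field_simp
    ring
  have hS : simplexSlice n k.val =
      {x | ∀ i, 0 ≤ x i ∧ x i ≤ 1} ∩ {x | ∀ i, d i ≤ f i x} := by
    ext x
    simp only [simplexSlice, Set.mem_inter_iff, Set.mem_ofPred_eq, Sum.forall, Subtype.forall,
      Prod.forall, Bool.forall_bool, f, d, Sum.elim_inl, Sum.elim_inr, if_true,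
      LinearMap.sub_apply, LinearMap.proj_apply, hsumL, sub_nonneg]
    simp only [Bool.false_eq_true, if_false, LinearMap.neg_apply, hsumL, neg_le_neg_iff]
    rw [antitone_iff_forall_lt]
    tauto
  rw [hS]
  refine hv.isPolytope_image h₁ h₂ f d x₀ (fun i => ?_) ?_
  · have h3 : (0 : ℝ) ≤ i.val := Nat.cast_nonneg _
    have h4 : (0 : ℝ) ≤ k.val := Nat.cast_nonneg _
    have h5 := hi i
    have h6 := hi k
    have e : x₀ i = ((2 * k.val + 1) * n + ((n - 1) / 2 - i.val)) / (2 * n ^ 2) := by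
      simp only [x₀]; field_simp
    rw [e]
    constructor
    · apply div_pos _ (by positivity)
      nlinarith
    · rw [div_lt_one (by positivity)]
      nlinarith
  · rintro (⟨⟨i, j⟩, hij⟩ | b)
    · have hij' : (i.val : ℝ) < j.val := by exact_mod_cast hij
      have : x₀ j < x₀ i := by
        simp only [x₀]
        gcongr
      simpa [f, d] using this
    · cases b
      · simp only [f, d, Sum.elim_inr, Bool.false_eq_true, if_false, LinearMap.neg_apply, hsumL,
          hsum₀]
        linarith
      · simp only [f, d, Sum.elim_inr, if_true, hsumL, hsum₀]
        linarith

/-- The slices with consecutive bounds on the coordinate sum dissect the Hill simplex. -/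
theorem IsHillFrame.isDissection_simplexSlice {n : ℕ} {w : ℝ} {v : Fin n → Euc n}
    (hv : IsHillFrame w v) (hn : 0 < n) (h₁ : 0 < 1 + w) (h₂ : 0 < 1 - w * ((n : ℝ) - 1)) :
    IsDissection (hillSimplex v) fun k : Fin n => frameMap v '' simplexSlice n k.val := by
  refine ⟨hv.isPolytope_simplexSlice h₁ h₂, ?_, ?_⟩
  · have key : ∀ i j : Fin n, i < j → Disjoint (interior (frameMap v '' simplexSlice n i.val))
        (interior (frameMap v '' simplexSlice n j.val)) := by
      intro i j hij
      have hij' : ((i.val + 1 : ℕ) : ℝ) ≤ j.val := by exact_mod_cast hij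
      push_cast at hij'
      refine hv.disjoint_interior h₁ h₂ _ (coordSum_ne_zero hn) (i.val + 1) ?_ ?_
      · rintro x ⟨-, -, -, h⟩
        simpa using h
      · rintro x ⟨-, -, h, -⟩
        simpa using hij'.trans h
    intro i j hij
    rcases lt_or_gt_of_ne hij with h | h
    · exact key i j h
    · exact (key j i h).symm
  · rw [← Set.image_iUnion, ← iUnion_simplexSlice hn]
    ext p
    simp only [hillSimplex, Set.mem_ofPred_eq, Set.mem_image, frameMap_apply]
    constructor
    · rintro ⟨μ, h1, h2, rfl⟩
      exact ⟨μ, ⟨h1, h2⟩, rfl⟩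
    · rintro ⟨μ, ⟨h1, h2⟩, rfl⟩
      exact ⟨μ, h1, h2, rfl⟩

/-- The screw motions carry the slices of the Hill simplex onto pieces that dissect a slab of the
cylinder. -/
theorem IsHillFrame.equidissectableVia_cylinderSlab {n : ℕ} {w : ℝ} {v v' : Fin n → Euc n}
    (hv : IsHillFrame w v) (hv' : IsHillFrame w v') (hn : 0 < n) (h₁ : 0 < 1 + w)
    (h₂ : 0 < 1 - w * ((n : ℝ) - 1)) :
    EquidissectableVia (hillSimplex v) (frameMap v' '' cylinderSlab n 0)
      fun k : Fin n => frameMap v '' simplexSlice n k.val := by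
  have : NeZero n := ⟨hn.ne'⟩
  have hg : ∀ k : Fin n, ∃ g : Euc n ≃ᵢ Euc n,
      g '' (frameMap v '' simplexSlice n k.val) = frameMap v' '' slabPiece n k := by
    intro k
    obtain ⟨g, hg⟩ := exists_isometryEquiv_frameMap hv hv' h₁ h₂ (Equiv.addRight k)
      fun j : Fin n => if j.val < k.val then -1 else 0
    refine ⟨g, ?_⟩
    have hg' : ∀ x, g (frameMap v x) = frameMap v' (cyclicShift k x) := hg
    rw [← image_cyclicShift_simplexSlice k, Set.image_image, Set.image_image]
    simp only [hg']
  refine ⟨hv.isDissection_simplexSlice hn h₁ h₂, fun k => frameMap v' '' slabPiece n k,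
    ⟨fun k => ?_, ?_, ?_⟩, hg⟩
  · obtain ⟨g, hgk⟩ := hg k
    have := (hv.isPolytope_simplexSlice h₁ h₂ k).image g
    rwa [hgk] at this
  · have key : ∀ i j : Fin n, i < j → Disjoint (interior (frameMap v' '' slabPiece n j))
        (interior (frameMap v' '' slabPiece n i)) := by
      intro i j hij
      have hij' : i.val < j.val := hij
      have hi := i.2
      -- the last coordinate that is nonnegative on the first piece is nonpositive on the second
      refine hv'.disjoint_interior h₁ h₂ _ (coordProj_ne_zero ⟨n - 1 - i.val, by lia⟩) 0 ?_ ?_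
      · rintro x ⟨-, h⟩
        exact (h _).2 (by simp only; lia)
      · rintro x ⟨-, h⟩
        exact (h _).1 (by simp only; lia)
    intro i j hij
    rcases lt_or_gt_of_ne hij with h | h
    · exact (key i j h).symm
    · exact key j i h
  · rw [← Set.image_iUnion, ← cylinderSlab_zero_eq_iUnion hn]

/-! ### The prism as a slab of the cylinder -/

/-- The point `(y, t)` of `ℝᵐ × ℝ = ℝᵐ⁺¹`. -/
noncomputable def prismPoint {m : ℕ} (y : Euc m) (t : ℝ) : Euc (m + 1) :=
  WithLp.toLp 2 fun i : Fin (m + 1) => if h : i.val < m then y ⟨i.val, h⟩ else t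

theorem prismPoint_castSucc {m : ℕ} (y : Euc m) (t : ℝ) (i : Fin m) :
    prismPoint y t i.castSucc = y i := by
  simp [prismPoint]

theorem prismPoint_last {m : ℕ} (y : Euc m) (t : ℝ) : prismPoint y t (Fin.last m) = t := by
  simp [prismPoint]

theorem inner_prismPoint {m : ℕ} (y z : Euc m) (s t : ℝ) :
    ⟪prismPoint y s, prismPoint z t⟫ = ⟪y, z⟫ + s * t := by
  simp only [PiLp.inner_apply, RCLike.inner_apply, conj_trivial, Fin.sum_univ_castSucc,
    prismPoint_castSucc, prismPoint_last, mul_comm t s]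

/-- The Hill frame whose cylinder is `c P × ℝ`: the vectors `(c u₁, l), …, (c uₘ, l)` and
`(c u₀, l)`, where `u₀ = -∑ uᵢ` completes the `uᵢ` to the vertices of a regular simplex. -/
noncomputable def prismFrame {m : ℕ} (u : Fin m → Euc m) (c l : ℝ) : Fin (m + 1) → Euc (m + 1) :=
  Fin.snoc (α := fun _ => Euc (m + 1)) (fun i => prismPoint (c • u i) l)
    (prismPoint (-(c • ∑ i, u i)) l)

theorem prismFrame_castSucc {m : ℕ} (u : Fin m → Euc m) (c l : ℝ) (i : Fin m) :
    prismFrame u c l i.castSucc = prismPoint (c • u i) l := by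
  simp [prismFrame]

theorem prismFrame_last {m : ℕ} (u : Fin m → Euc m) (c l : ℝ) :
    prismFrame u c l (Fin.last m) = prismPoint (-(c • ∑ i, u i)) l := by
  simp [prismFrame]

theorem isHillFrame_prismFrame {m : ℕ} (hm : 0 < m) {w c l : ℝ} {u : Fin m → Euc m}
    (hu : IsHillFrame (1 / (m : ℝ)) u) (hc : c ^ 2 = m * (w + 1) / (m + 1))
    (hl : l ^ 2 = (1 - w * m) / (m + 1)) : IsHillFrame w (prismFrame u c l) := by
  have hm' : (m : ℝ) ≠ 0 := by positivity
  have hm1 : (m : ℝ) + 1 ≠ 0 := by positivity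
  have hsum : ∑ i, u i = frameMap u fun _ => 1 := by simp [frameMap_apply]
  have hui : ∀ i, u i = frameMap u (Pi.single i 1) := by
    intro i; simp [frameMap_apply, Pi.single_apply, ite_smul]
  have h1 : ∀ i, ⟪u i, ∑ j, u j⟫ = 1 / m := by
    intro i
    rw [hsum, hui i, hu.inner_frameMap]
    simp [Pi.single_apply]
    field_simp
    ring
  have h2 : ⟪∑ j, u j, ∑ j, u j⟫ = 1 := by
    rw [sum_inner, Finset.sum_congr rfl fun i _ => h1 i]
    simp
    field_simp
  have h3 : ∀ i, ⟪u i, u i⟫ = 1 := fun i => by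
    rw [real_inner_self_eq_norm_sq, hu.1 i, one_pow]
  have hdiag : c ^ 2 + l ^ 2 = 1 := by rw [hc, hl]; field_simp; ring
  have hoff : -(c ^ 2 / m) + l ^ 2 = -w := by rw [hc, hl]; field_simp; ring
  refine ⟨fun i => ?_, fun i j => ?_⟩
  · rw [← pow_eq_one_iff_of_nonneg (norm_nonneg _) two_ne_zero, ← real_inner_self_eq_norm_sq]
    refine Fin.lastCases ?_ (fun i => ?_) i
    · rw [prismFrame_last, inner_prismPoint, inner_neg_neg, real_inner_smul_left,
        real_inner_smul_right, h2]
      linear_combination hdiag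
    · rw [prismFrame_castSucc, inner_prismPoint, real_inner_smul_left, real_inner_smul_right, h3]
      linear_combination hdiag
  · refine Fin.lastCases ?_ (fun i => ?_) i <;> refine Fin.lastCases ?_ (fun j => ?_) j
    · intro h; exact absurd rfl h
    · intro _
      rw [prismFrame_last, prismFrame_castSucc, inner_prismPoint, inner_neg_left,
        real_inner_smul_left, real_inner_smul_right, real_inner_comm, h1]
      linear_combination hoff
    · intro _
      rw [prismFrame_last, prismFrame_castSucc, inner_prismPoint, inner_neg_right,
        real_inner_smul_left, real_inner_smul_right, h1]
      linear_combination hoff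
    · intro h
      rw [prismFrame_castSucc, prismFrame_castSucc, inner_prismPoint,
        real_inner_smul_left, real_inner_smul_right, hu.2 i j fun e => h (by rw [e])]
      linear_combination hoff

theorem frameMap_prismFrame {m : ℕ} (u : Fin m → Euc m) (c l : ℝ) (x : Fin (m + 1) → ℝ) :
    frameMap (prismFrame u c l) x =
      prismPoint (c • ∑ i : Fin m, (x i.castSucc - x (Fin.last m)) • u i) (l * ∑ i, x i) := by
  rw [frameMap_apply, Fin.sum_univ_castSucc]
  simp only [prismFrame_castSucc, prismFrame_last]
  ext j
  refine Fin.lastCases ?_ (fun j => ?_) j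
  · simp only [PiLp.add_apply, WithLp.ofLp_sum, Finset.sum_apply, PiLp.smul_apply, prismPoint_last,
      smul_eq_mul, Fin.sum_univ_castSucc, ← Finset.sum_mul]
    ring
  · simp only [PiLp.add_apply, WithLp.ofLp_sum, Finset.sum_apply, PiLp.smul_apply, PiLp.neg_apply,
      prismPoint_castSucc, smul_eq_mul, sub_mul, Finset.sum_sub_distrib, ← Finset.mul_sum,
      mul_left_comm _ c]
    ring

/-- The differences of the coordinates to the last one give the point of the base, and the
coordinate sum gives the height. -/
theorem prism_smul_hillSimplex {m : ℕ} (u : Fin m → Euc m) (c : ℝ) {l : ℝ} (hl : 0 < l) :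
    prism (n := m + 1) (c • hillSimplex u) l =
      frameMap (prismFrame u c l) '' cylinderSlab (m + 1) 0 := by
  apply Set.Subset.antisymm
  · rintro _ ⟨_, ⟨_, ⟨μ, hμ, hb, rfl⟩, rfl⟩, t, ht, rfl⟩
    -- the last coordinate is determined by the height `t = l * ∑ x i`
    set s := (t / l - ∑ i, μ i) / (m + 1) with hs
    let x : Fin (m + 1) → ℝ := Fin.snoc (α := fun _ => ℝ) (fun i => μ i + s) s
    have hxc : ∀ i : Fin m, x i.castSucc = μ i + s := fun i => by simp [x]
    have hxl : x (Fin.last m) = s := by simp [x]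
    have hsum : ∑ i, x i = t / l := by
      rw [Fin.sum_univ_castSucc, hxl]
      simp only [hxc, Finset.sum_add_distrib, Finset.sum_const, Finset.card_univ, Fintype.card_fin,
        nsmul_eq_mul]
      rw [hs]
      field_simp
      ring
    refine ⟨x, ⟨?_, ?_, ?_, ?_⟩, ?_⟩
    · intro i j
      refine Fin.lastCases ?_ (fun i => ?_) i <;> refine Fin.lastCases ?_ (fun j => ?_) j
      · intro _; exact le_rfl
      · intro h; exact absurd h (not_le.2 (Fin.castSucc_lt_last j))
      · intro _; rw [hxc, hxl]; linarith [(hb i).1]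
      · intro h; rw [hxc, hxc]; linarith [hμ (Fin.castSucc_le_castSucc_iff.1 h)]
    · intro i j
      refine Fin.lastCases ?_ (fun i => ?_) i <;> refine Fin.lastCases ?_ (fun j => ?_) j
      · linarith
      · rw [hxc, hxl]; linarith [(hb j).1]
      · rw [hxc, hxl]; linarith [(hb i).2]
      · rw [hxc, hxc]; linarith [(hb i).2, (hb j).1]
    · rw [hsum]; exact div_nonneg ht.1 hl.le
    · rw [hsum, zero_add]; exact (div_le_one hl).2 ht.2
    · rw [frameMap_prismFrame, hsum, mul_div_cancel₀ _ hl.ne']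
      simp only [hxc, hxl, add_sub_cancel_right]
      rfl
  · rintro _ ⟨x, ⟨ha, hc, h0, h1⟩, rfl⟩
    refine ⟨_, ⟨_, ⟨fun i => x i.castSucc - x (Fin.last m), ?_, ?_, rfl⟩, rfl⟩, l * ∑ i, x i,
      ⟨by positivity, ?_⟩, ?_⟩
    · intro i j hij
      simp only
      linarith [ha (Fin.castSucc_le_castSucc_iff.2 hij)]
    · intro i
      constructor
      · linarith [ha (Fin.castSucc_lt_last i).le]
      · linarith [hc i.castSucc (Fin.last m)]
    · nlinarith
    · rw [frameMap_prismFrame]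
      rfl

/-! ### The pieces of the standard realization -/

theorem sum_frameMap_stdFrame {n : ℕ} (hn : 0 < n) (w : ℝ) (x : Fin n → ℝ) :
    ∑ j, frameMap (stdFrame n w) x j = √(1 - w * ((n : ℝ) - 1)) * ∑ i, x i := by
  have hn' : (n : ℝ) ≠ 0 := by positivity
  have h : ∀ i, ∑ j, stdFrame n w i j = √(1 - w * ((n : ℝ) - 1)) := by
    intro i
    have e : ∀ j, stdFrame n w i j = frameB n w + if j = i then √(1 + w) else 0 := by
      intro j
      simp only [stdFrame, frameA]
      split_ifs <;> simp
    simp only [e, Finset.sum_add_distrib, Finset.sum_ite_eq', Finset.mem_univ, if_true,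
      Finset.sum_const, Finset.card_univ, Fintype.card_fin, nsmul_eq_mul, frameB]
    field_simp
    ring
  simp only [frameMap_apply, WithLp.ofLp_sum, Finset.sum_apply, PiLp.smul_apply, smul_eq_mul]
  rw [Finset.sum_comm]
  simp only [← Finset.mul_sum, h]
  rw [← Finset.sum_mul, mul_comm]

/-- The coordinate sum of a point in `ℝⁿ` is `√(1 - w (n - 1))` times the sum of its coordinates
with respect to the standard frame, so that the hyperplanes cut at integral values of the latter. -/
theorem hillPiece_eq_image {n : ℕ} (w : ℝ) (h₂ : 0 < 1 - w * ((n : ℝ) - 1)) (k : Fin n) :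
    hillPiece n w k = frameMap (stdFrame n w) '' simplexSlice n k.val := by
  have hs := Real.sqrt_pos.2 h₂
  ext p
  constructor
  · rintro ⟨⟨μ, ha, hb, rfl⟩, h1, h2⟩
    rw [← frameMap_apply, sum_frameMap_stdFrame k.pos] at h1 h2
    exact ⟨μ, ⟨ha, hb, le_of_mul_le_mul_left ((mul_comm _ _).trans_le h1) hs,
      le_of_mul_le_mul_left (h2.trans_eq (mul_comm _ _)) hs⟩, frameMap_apply _ _⟩
  · rintro ⟨μ, ⟨ha, hb, h1, h2⟩, rfl⟩
    refine ⟨⟨μ, ha, hb, frameMap_apply _ _⟩, ?_, ?_⟩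
    · rw [sum_frameMap_stdFrame k.pos, mul_comm]
      exact mul_le_mul_of_nonneg_left h1 hs.le
    · rw [sum_frameMap_stdFrame k.pos, mul_comm]
      exact mul_le_mul_of_nonneg_right h2 hs.le

/-! ### The half-turns of the three-dimensional dissection -/

theorem halfTurn_apply {n : ℕ} (a b x : Euc n) :
    halfTurn a b x = (2 * (⟪b - a, x - a⟫ / ‖b - a‖ ^ 2)) • (b - a) - (x - a) + a := by
  have ha : a ∈ affineSpan ℝ ({a, b} : Set (Euc n)) := left_mem_affineSpan_pair ℝ a b
  have hdir : (affineSpan ℝ ({a, b} : Set (Euc n))).direction = Submodule.span ℝ {b - a} := by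
    rw [direction_affineSpan, vectorSpan_pair_rev]; rfl
  -- the orthogonal projections are part of the instances, so the subspace cannot be rewritten
  have hcongr : ∀ (K K' : Submodule ℝ (Euc n)) (_ : K = K') [K.HasOrthogonalProjection]
      [K'.HasOrthogonalProjection] (y : Euc n), K.reflection y = K'.reflection y := by
    rintro K _ rfl _ _ y; rfl
  rw [halfTurn, EuclideanGeometry.reflection_apply_of_mem _ _ ha, hcongr _ _ hdir,
    Submodule.reflection_singleton_apply]
  simp [two_smul, two_mul, add_smul]

theorem hillVertex_eq_frameMap (n : ℕ) (w : ℝ) (k : ℕ) :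
    hillVertex n w k = frameMap (stdFrame n w) fun i => if i.val < k then 1 else 0 := by
  simp [hillVertex, frameMap_apply, ite_smul]

/-- If the direction of the axis has coordinate sum zero, then the half-turn is the same in the
coordinates as for an orthonormal basis. -/
theorem IsHillFrame.halfTurn_frameMap {n : ℕ} {w : ℝ} {v : Fin n → Euc n}
    (hv : IsHillFrame w v) (h₁ : 0 < 1 + w) (α β x : Fin n → ℝ) (hαβ : ∑ i, (β - α) i = 0) :
    halfTurn (frameMap v α) (frameMap v β) (frameMap v x) = frameMap v
      ((2 * ((∑ i, (β - α) i * (x - α) i) / ∑ i, (β - α) i ^ 2)) • (β - α) - (x - α) + α) := by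
  rw [halfTurn_apply]
  simp only [← map_sub, hv.inner_frameMap, hv.norm_frameMap_sq, hαβ]
  rw [zero_mul, mul_zero, sub_zero, zero_pow two_ne_zero, mul_zero, sub_zero,
    mul_div_mul_left _ _ h₁.ne']
  simp only [← map_smul, ← map_sub, ← map_add]

/-- The half-turn that moves the piece at `u_0`; it replaces the coordinate sum `s` by `2 - s`. -/
theorem halfTurn_lower {w : ℝ} (h₁ : 0 < 1 + w) (hv : IsHillFrame w (stdFrame 3 w))
    (x : Fin 3 → ℝ) :
    halfTurn (hillVertex 3 w 1) (midpoint ℝ (hillVertex 3 w 0) (hillVertex 3 w 2))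
      (frameMap (stdFrame 3 w) x) = frameMap (stdFrame 3 w) ![1 - x 1, 1 - x 0, -x 2] := by
  have e1 : hillVertex 3 w 1 = frameMap (stdFrame 3 w) ![1, 0, 0] := by
    rw [hillVertex_eq_frameMap]; congr 1; ext i; fin_cases i <;> simp
  have e2 : midpoint ℝ (hillVertex 3 w 0) (hillVertex 3 w 2) =
      frameMap (stdFrame 3 w) ![1 / 2, 1 / 2, 0] := by
    rw [hillVertex_eq_frameMap, hillVertex_eq_frameMap, midpoint_eq_smul_add, ← map_add,
      ← map_smul]
    congr 1; ext i; fin_cases i <;> simp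
  rw [e1, e2, hv.halfTurn_frameMap h₁ _ _ _ (by simp [Fin.sum_univ_three]; norm_num)]
  congr 1
  ext i
  obtain rfl | rfl | rfl : i = 0 ∨ i = 1 ∨ i = 2 := by fin_cases i <;> simp
  all_goals
    simp only [Pi.add_apply, Pi.sub_apply, Pi.smul_apply, smul_eq_mul, Fin.sum_univ_three,
      Matrix.cons_val]
    field_simp
    ring

/-- The half-turn that moves the piece at `u_3`; it replaces the coordinate sum `s` by `4 - s`. -/
theorem halfTurn_upper {w : ℝ} (h₁ : 0 < 1 + w) (hv : IsHillFrame w (stdFrame 3 w))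
    (x : Fin 3 → ℝ) :
    halfTurn (hillVertex 3 w 2) (midpoint ℝ (hillVertex 3 w 1) (hillVertex 3 w 3))
      (frameMap (stdFrame 3 w) x) = frameMap (stdFrame 3 w) ![2 - x 0, 1 - x 2, 1 - x 1] := by
  have e1 : hillVertex 3 w 2 = frameMap (stdFrame 3 w) ![1, 1, 0] := by
    rw [hillVertex_eq_frameMap]; congr 1; ext i; fin_cases i <;> simp
  have e2 : midpoint ℝ (hillVertex 3 w 1) (hillVertex 3 w 3) =
      frameMap (stdFrame 3 w) ![1, 1 / 2, 1 / 2] := by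
    rw [hillVertex_eq_frameMap, hillVertex_eq_frameMap, midpoint_eq_smul_add, ← map_add,
      ← map_smul]
    congr 1; ext i; fin_cases i <;> norm_num
  rw [e1, e2, hv.halfTurn_frameMap h₁ _ _ _ (by simp [Fin.sum_univ_three]; norm_num)]
  congr 1
  ext i
  obtain rfl | rfl | rfl : i = 0 ∨ i = 1 ∨ i = 2 := by fin_cases i <;> simp
  all_goals
    simp only [Pi.add_apply, Pi.sub_apply, Pi.smul_apply, smul_eq_mul, Fin.sum_univ_three,
      Matrix.cons_val]
    field_simp
    ring

theorem mem_simplexSlice_three {k : ℝ} {x : Fin 3 → ℝ} : x ∈ simplexSlice 3 k ↔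
    x 1 ≤ x 0 ∧ x 2 ≤ x 1 ∧ 0 ≤ x 2 ∧ x 0 ≤ 1 ∧
      k ≤ x 0 + x 1 + x 2 ∧ x 0 + x 1 + x 2 ≤ k + 1 := by
  simp only [simplexSlice, Set.mem_ofPred_eq, Fin.antitone_iff_succ_le, Fin.forall_fin_succ,
    Fin.sum_univ_three]
  constructor
  · rintro ⟨⟨h1, h2, -⟩, ⟨h3, h4, h5, -⟩, h6, h7⟩
    exact ⟨h1, h2, h5.1, h3.2, h6, h7⟩
  · rintro ⟨h1, h2, h3, h4, h5, h6⟩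
    have e1 : x (Fin.succ 0) = x 1 := rfl
    have e2 : x (Fin.succ 0).succ = x 2 := rfl
    refine ⟨⟨h1, h2, fun i => i.elim0⟩, ⟨⟨?_, ?_⟩, ⟨?_, ?_⟩, ⟨?_, ?_⟩, fun i => i.elim0⟩,
      h5, h6⟩ <;>
      linarith

theorem mem_cylinderSlab_three {a : ℝ} {x : Fin 3 → ℝ} : x ∈ cylinderSlab 3 a ↔
    x 1 ≤ x 0 ∧ x 2 ≤ x 1 ∧ x 0 - 1 ≤ x 2 ∧
      a ≤ x 0 + x 1 + x 2 ∧ x 0 + x 1 + x 2 ≤ a + 1 := by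
  simp only [cylinderSlab, Set.mem_ofPred_eq, Fin.antitone_iff_succ_le, Fin.forall_fin_succ,
    Fin.sum_univ_three]
  constructor
  · rintro ⟨⟨h1, h2, -⟩, ⟨⟨-, -, h3, -⟩, -⟩, h6, h7⟩
    exact ⟨h1, h2, h3, h6, h7⟩
  · rintro ⟨h1, h2, h3, h5, h6⟩
    have e1 : x (Fin.succ 0) = x 1 := rfl
    have e2 : x (Fin.succ 0).succ = x 2 := rfl
    refine ⟨⟨h1, h2, fun i => i.elim0⟩, ⟨⟨?_, ?_, ?_, fun i => i.elim0⟩,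
      ⟨?_, ?_, ?_, fun i => i.elim0⟩, ⟨?_, ?_, ?_, fun i => i.elim0⟩, fun i => i.elim0⟩, h5, h6⟩ <;>
      linarith

/-- In coordinates, the three placed pieces are cut out of the slab `1 ≤ ∑ x i ≤ 2` of the cylinder
by the walls `x 0 ≤ 1` and `0 ≤ x 2` of the simplex: the middle piece satisfies both, each of the
turned pieces lies beyond one of them. -/
theorem schobiPiece_eq_image {w : ℝ} (h₁ : 0 < 1 + w) (h₂ : 0 < 1 - w * (((3 : ℕ) : ℝ) - 1))
    (hv : IsHillFrame w (stdFrame 3 w)) :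
    schobiPiece 3 w 0 = frameMap (stdFrame 3 w) '' {x ∈ cylinderSlab 3 1 | 0 ≤ x 1 ∧ x 2 ≤ 0} ∧
    schobiPiece 3 w 1 = frameMap (stdFrame 3 w) '' {x ∈ cylinderSlab 3 1 | x 0 ≤ 1 ∧ 0 ≤ x 2} ∧
    schobiPiece 3 w 2 = frameMap (stdFrame 3 w) '' {x ∈ cylinderSlab 3 1 | 1 ≤ x 0 ∧ x 1 ≤ 1} := by
  refine ⟨?_, ?_, ?_⟩
  · rw [schobiPiece, if_pos (by rfl), hillPiece_eq_image w h₂]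
    ext p
    simp only [Set.mem_image, exists_exists_and_eq_and, halfTurn_lower h₁ hv, Set.mem_ofPred_eq,
      mem_simplexSlice_three, mem_cylinderSlab_three, Fin.val_zero, Nat.cast_zero]
    constructor
    · rintro ⟨x, h, rfl⟩
      refine ⟨_, ?_, rfl⟩
      simp only [Matrix.cons_val]
      refine ⟨⟨?_, ?_, ?_, ?_, ?_⟩, ?_, ?_⟩ <;> linarith
    · rintro ⟨x, h, rfl⟩
      refine ⟨![1 - x 1, 1 - x 0, -x 2], ?_, ?_⟩
      · simp only [Matrix.cons_val]
        refine ⟨?_, ?_, ?_, ?_, ?_, ?_⟩ <;> linarith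
      · congr 1; ext i; fin_cases i <;> simp
  · rw [schobiPiece, if_neg (by decide), if_neg (by decide), hillPiece_eq_image w h₂]
    congr 1
    ext x
    simp only [mem_simplexSlice_three, mem_cylinderSlab_three, Set.mem_ofPred_eq, Fin.val_one,
      Nat.cast_one]
    constructor
    · intro h
      refine ⟨⟨?_, ?_, ?_, ?_, ?_⟩, ?_, ?_⟩ <;> linarith
    · intro h
      refine ⟨?_, ?_, ?_, ?_, ?_, ?_⟩ <;> linarith
  · rw [schobiPiece, if_neg (by decide), if_pos (by rfl), hillPiece_eq_image w h₂]
    ext p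
    simp only [Set.mem_image, exists_exists_and_eq_and, halfTurn_upper h₁ hv, Set.mem_ofPred_eq,
      mem_simplexSlice_three, mem_cylinderSlab_three, Fin.val_two, Nat.cast_ofNat]
    constructor
    · rintro ⟨x, h, rfl⟩
      refine ⟨_, ?_, rfl⟩
      simp only [Matrix.cons_val]
      refine ⟨⟨?_, ?_, ?_, ?_, ?_⟩, ?_, ?_⟩ <;> linarith
    · rintro ⟨x, h, rfl⟩
      refine ⟨![2 - x 0, 1 - x 2, 1 - x 1], ?_, ?_⟩
      · simp only [Matrix.cons_val]
        refine ⟨?_, ?_, ?_, ?_, ?_, ?_⟩ <;> linarith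
      · congr 1; ext i; fin_cases i <;> simp

theorem isPolytope_schobiPiece {w : ℝ} (h₁ : 0 < 1 + w) (h₂ : 0 < 1 - w * (((3 : ℕ) : ℝ) - 1))
    (hv : IsHillFrame w (stdFrame 3 w)) (k : Fin 3) : IsPolytope (schobiPiece 3 w k) := by
  have h : IsPolytope (hillPiece 3 w k) := by
    rw [hillPiece_eq_image w h₂]
    exact hv.isPolytope_simplexSlice h₁ h₂ k
  unfold schobiPiece
  split_ifs
  · exact h.image (halfTurn _ _).toIsometryEquiv
  · exact h.image (halfTurn _ _).toIsometryEquiv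
  · exact h

theorem isDissection_schobiPiece {w : ℝ} (h₁ : 0 < 1 + w) (h₂ : 0 < 1 - w * (((3 : ℕ) : ℝ) - 1))
    (hv : IsHillFrame w (stdFrame 3 w)) :
    IsDissection (frameMap (stdFrame 3 w) '' cylinderSlab 3 1) (schobiPiece 3 w) := by
  obtain ⟨e0, e1, e2⟩ := schobiPiece_eq_image h₁ h₂ hv
  refine ⟨isPolytope_schobiPiece h₁ h₂ hv, ?_, ?_⟩
  · have d01 : Disjoint (interior (schobiPiece 3 w 0)) (interior (schobiPiece 3 w 1)) := by
      rw [e0, e1]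
      exact hv.disjoint_interior h₁ h₂ _ (coordProj_ne_zero 2) 0 (fun x h => h.2.2)
        fun x h => h.2.2
    have d02 : Disjoint (interior (schobiPiece 3 w 0)) (interior (schobiPiece 3 w 2)) := by
      rw [e0, e2]
      refine hv.disjoint_interior h₁ h₂ _ (coordProj_ne_zero 2) 0 (fun x h => h.2.2) ?_
      rintro x ⟨hx, h0, -⟩
      have := (mem_cylinderSlab_three.1 hx).2.2.1
      simp only [LinearMap.proj_apply]
      linarith
    have d12 : Disjoint (interior (schobiPiece 3 w 1)) (interior (schobiPiece 3 w 2)) := by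
      rw [e1, e2]
      exact hv.disjoint_interior h₁ h₂ _ (coordProj_ne_zero 0) 1 (fun x h => h.2.1)
        fun x h => h.2.1
    intro i j hij
    fin_cases i <;> fin_cases j <;>
      first
      | exact absurd rfl hij
      | exact d01
      | exact d02
      | exact d12
      | exact d01.symm
      | exact d02.symm
      | exact d12.symm
  · have hU : (⋃ i, schobiPiece 3 w i) =
        schobiPiece 3 w 0 ∪ schobiPiece 3 w 1 ∪ schobiPiece 3 w 2 := by
      ext p
      simp only [Set.mem_iUnion, Fin.exists_fin_succ, Set.mem_union]
      simp [or_assoc]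
    rw [hU, e0, e1, e2, ← Set.image_union, ← Set.image_union]
    congr 1
    ext x
    simp only [Set.mem_union, Set.mem_ofPred_eq, ← and_or_left]
    refine ⟨fun hx => ⟨hx, ?_⟩, fun hx => hx.1⟩
    obtain ⟨h1, h2, h3, h4, h5⟩ := mem_cylinderSlab_three.1 hx
    rcases le_total (x 2) 0 with h | h
    · exact Or.inl (Or.inl ⟨by linarith, h⟩)
    -- `x 0 ≥ 1` and `x 2 ≥ 0` force `x 1 ≤ 1`, because the sum is at most `2`
    · rcases le_total (x 0) 1 with h' | h'
      · exact Or.inl (Or.inr ⟨h', h⟩)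
      · exact Or.inr ⟨h', by linarith⟩

/-- The screw motion carries the slab `0 ≤ ∑ x i ≤ 1` of a cylinder onto the slab
`1 ≤ ∑ x i ≤ 2`. -/
theorem exists_isometryEquiv_cylinderSlab_one {w : ℝ} {v v' : Fin 3 → Euc 3}
    (hv : IsHillFrame w v) (hv' : IsHillFrame w v') (h₁ : 0 < 1 + w)
    (h₂ : 0 < 1 - w * (((3 : ℕ) : ℝ) - 1)) :
    ∃ g : Euc 3 ≃ᵢ Euc 3,
      g '' (frameMap v '' cylinderSlab 3 0) = frameMap v' '' cylinderSlab 3 1 := by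
  obtain ⟨g, hg⟩ := exists_isometryEquiv_frameMap hv hv' h₁ h₂ (Equiv.addRight 2) ![0, 0, 1]
  have hg' : ∀ x, g (frameMap v x) = frameMap v' ![x 2 + 1, x 0, x 1] := by
    intro x
    rw [hg]
    congr 1; ext i; fin_cases i <;> simp
  refine ⟨g, ?_⟩
  ext p
  simp only [Set.mem_image, exists_exists_and_eq_and, hg', mem_cylinderSlab_three]
  constructor
  · rintro ⟨x, h, rfl⟩
    refine ⟨_, ?_, rfl⟩
    simp only [Matrix.cons_val]
    refine ⟨?_, ?_, ?_, ?_, ?_⟩ <;> linarith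
  · rintro ⟨x, h, rfl⟩
    refine ⟨![x 1, x 2, x 0 - 1], ?_, ?_⟩
    · simp only [Matrix.cons_val]
      refine ⟨?_, ?_, ?_, ?_, ?_⟩ <;> linarith
    · congr 1; ext i; fin_cases i <;> simp

/-! ### Equidissectability of Hill simplices and prisms -/

theorem theorem2 (n : ℕ) (hn : 2 ≤ n) (w : ℝ) (hw₁ : -1 < w) (hw₂ : w < 1 / ((n : ℝ) - 1))
    (c l : ℝ) (hc : c = √(((n : ℝ) - 1) * (w + 1) / n)) (hl : l = √((1 - w * ((n : ℝ) - 1)) / n)) :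
    (∀ (v : Fin n → Euc n) (u : Fin (n - 1) → Euc (n - 1)),
      IsHillFrame w v → IsHillFrame (1 / ((n : ℝ) - 1)) u →
        Equidissectable (hillSimplex v) (prism (c • hillSimplex u) l)) ∧
    EquidissectableVia (hillQ n w) (prism (c • hillP (n - 1)) l) (hillPiece n w) ∧
    (n = 3 → ∃ g : Euc n ≃ᵢ Euc n,
      IsDissection (g '' prism (c • hillP (n - 1)) l) (schobiPiece n w)) := by
  obtain ⟨m, rfl⟩ : ∃ m, n = m + 1 := ⟨n - 1, by lia⟩
  have hm : 0 < m := by lia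
  have hm' : (0 : ℝ) < m := by exact_mod_cast hm
  have hcast : ((m + 1 : ℕ) : ℝ) - 1 = m := by push_cast; ring
  have h₁ : 0 < 1 + w := by linarith
  have h₂ : 0 < 1 - w * (((m + 1 : ℕ) : ℝ) - 1) := by
    rw [hcast] at hw₂ ⊢
    rw [lt_div_iff₀ hm'] at hw₂
    linarith
  have hc2 : c ^ 2 = m * (w + 1) / (m + 1) := by
    have : 0 ≤ w + 1 := by linarith
    rw [hc, hcast, Real.sq_sqrt (by positivity)]
    push_cast; rfl
  have hlpos : 0 < l := by
    rw [hl]; exact Real.sqrt_pos.2 (div_pos h₂ (by positivity))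
  have hl2 : l ^ 2 = (1 - w * m) / (m + 1) := by
    rw [hl, Real.sq_sqrt (div_pos h₂ (by positivity)).le, hcast]
    push_cast; rfl
  have hmain : ∀ (v : Fin (m + 1) → Euc (m + 1)) (u : Fin m → Euc m), IsHillFrame w v →
      IsHillFrame (1 / (m : ℝ)) u →
      EquidissectableVia (hillSimplex v) (prism (n := m + 1) (c • hillSimplex u) l)
        fun k : Fin (m + 1) => frameMap v '' simplexSlice (m + 1) k.val := by
    intro v u hv hu
    rw [prism_smul_hillSimplex u c hlpos]
    exact hv.equidissectableVia_cylinderSlab (isHillFrame_prismFrame hm hu hc2 hl2) m.succ_pos h₁ h₂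
  have hstd : IsHillFrame w (stdFrame (m + 1) w) :=
    isHillFrame_stdFrame m.succ_pos h₁.le h₂.le
  have hstd' : IsHillFrame (1 / (m : ℝ)) (stdFrame m (1 / (m : ℝ))) := by
    refine isHillFrame_stdFrame hm (by positivity) ?_
    have : 1 - 1 / (m : ℝ) * ((m : ℝ) - 1) = 1 / m := by field_simp; ring
    rw [this]
    positivity
  refine ⟨fun v u hv hu => ?_, ?_, ?_⟩
  · rw [hcast] at hu
    exact ⟨m + 1, _, m.succ_pos, hmain v u hv hu⟩
  · have hp : hillPiece (m + 1) w = fun k : Fin (m + 1) =>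
        frameMap (stdFrame (m + 1) w) '' simplexSlice (m + 1) k.val :=
      funext fun k => hillPiece_eq_image w h₂ k
    rw [hp]
    exact hmain _ _ hstd hstd'
  · intro h3
    obtain rfl : m = 2 := by lia
    obtain ⟨g, hg⟩ := exists_isometryEquiv_cylinderSlab_one
      (isHillFrame_prismFrame hm hstd' hc2 hl2) hstd h₁ h₂
    refine ⟨g, ?_⟩
    have hP : prism (n := 3) (c • hillP 2) l =
        frameMap (prismFrame (stdFrame 2 (1 / ((2 : ℕ) : ℝ))) c l) '' cylinderSlab 3 0 :=
      prism_smul_hillSimplex _ c hlpos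
    have := isDissection_schobiPiece h₁ h₂ hstd
    rw [← hg, ← hP] at this
    exact this
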